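/- A two-stage causal MDP starts at state $0$, moves to one of the intermediate states $1,\dots,k$, emits a reward in $\{0,1\}$ and stops. At each state $i\in\{0,\dots,k\}$ there are $n$ independent observable Bernoulli variables $X^i_1,\dots,X^i_n$ with $q^i_j=\mathbb P\{X^i_j=1\}$. The set $\mathcal I_i$ of atomic interventions at $i$ consists of $do()$, $do(X^i_j=0)$ and $do(X^i_j=1)$, $j\in[n]$. The law of the next state depends on $X^0_1,\dots,X^0_n$, and the law of the reward $R_i$ emitted at $i$ depends on $X^i_1,\dots,X^i_n$. Write $P_{(a,i)}=\mathbb P\{i\mid a\}$ for $a\in\mathcal I_0$, $i\in[k]$, and let $p_+$ be the smallest nonzero entry of $P$. Let $m_i=\max\{j: q^i_{(j)}<1/j\}$, where $q^i_{(1)}\le\dots\le q^i_{(n)}$ are the numbers $\min(q^i_j,1-q^i_j)$ in increasing order, $M=\mathrm{diag}(m_1,\dots,m_k)$ and $$\lambda=\min_{f}\left\lVert PM^{1/2}(P^\top f)^{\circ-\frac12}\right\rVert_\infty^2,$$ where $f$ ranges over the probability vectors on $\mathcal I_0$ and $v^{\circ-\frac12}$ is the entrywise power (with $0^{-1/2}=\infty$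 and $0\cdot\infty=0$). A policy $\pi$ chooses an intervention at every state; $\varepsilon(\pi)$ is the expected reward of an optimal policy minus that of $\pi$. An algorithm with time budget $T$ plays $T$ rounds, choosing (adaptively, possibly at random) an intervention at state $0$ and then one at the state reached, observes all variables at the visited states and the reward, and finally returns a policy $\widehat\pi$; $\mathrm{Regret}_T=\mathbb E[\varepsilon(\widehat\pi)]$. Theorem 2 (lower bound). There is a universal constant $c>0$ such that for every $k\ge2$, with $n=k-1$, there are probabilities $q^0_j$ and a transition law at state $0$ for which $P$ is deterministic (every entry of $P$ is $0$ or $1$) and the following holds. (i) For all $q^i_j\in[0,1]$ ($i\in[k]$) and all reward distributions, $\lambda=\sum_{\ell\in[k]}m_\ell$, the minimum defining $\lambda$ is attained, and $m_0/p_+\le\lambda$, so that $\max\{\lambda,m_0/p_+\}=\lambda$. (ii) For every $T\ge1$ there is a finite family of reward distributions such that, for all $q^i_j\in[0,1]$ ($i\in[k]$) and every algorithm, on some instance of the family $$\mathrm{Regret}_T\ \ge\ c\,\min\left\{1,\sqrt{\lambda/T}\right\};$$ in particular $\mathrm{Regret}_T\ge c\sqrt{\lambda/T}$ whenever $T\ge\lambda$.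 By (i), the lower bound (ii) matches, up to a logarithmic factor, an upper bound of order $\sqrt{\frac1T\max\{\lambda,\frac{m_0}{p_+}\}\log(NT)}$, where $N=2n+1$. -/

import Mathlib

open scoped ENNReal

/-- Atomic interventions on `n` binary variables: `none` is the empty intervention `do()`,
and `some (j, b)` is `do(X_j = b)`. There are `2 n + 1` of them. -/
abbrev Intervention (n : ℕ) : Type := Option (Fin n × Bool)

/-- A realization of the `n` binary variables at a state. -/
abbrev Realization (n : ℕ) : Type := Fin n → Bool

/-- The Bernoulli law on `Bool` that gives `true` the probability `p`. -/
noncomputable def coin (p : unitInterval) : PMF Bool :=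
  PMF.ofFintype (fun b => cond b (ENNReal.ofReal (p : ℝ)) (ENNReal.ofReal (1 - (p : ℝ)))) (by
    rw [Fintype.sum_bool, cond_true, cond_false,
      ← ENNReal.ofReal_add p.2.1 (sub_nonneg.2 p.2.2)]
    simp)

/-- The law of the variable `X_j` when the intervention `a` is performed and the variables
have success probabilities `q`. -/
noncomputable def coordLaw {n : ℕ} (q : Fin n → unitInterval) (a : Intervention n) (j : Fin n) :
    PMF Bool :=
  match a with
  | none => coin (q j)
  | some (j', b) => if j' = j then PMF.pure b else coin (q j)

/-- The joint law of the (independent) variables `X_1, …, X_n` under the intervention `a`. -/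
noncomputable def varLaw {n : ℕ} (q : Fin n → unitInterval) (a : Intervention n) :
    PMF (Realization n) :=
  PMF.ofFintype (fun x => ∏ j, coordLaw q a j (x j)) (by
    have h := Finset.prod_univ_sum (fun _ : Fin n => (Finset.univ : Finset Bool))
      (fun j b => coordLaw q a j b)
    rw [Fintype.piFinset_univ] at h
    rw [← h]
    refine Finset.prod_eq_one fun j _ => ?_
    rw [← tsum_fintype (L := .unconditional Bool)]
    exact (coordLaw q a j).tsum_coe)

/-- The smaller of `q_j` and `1 - q_j`. -/
noncomputable def lesserProb {n : ℕ} (q : Fin n → unitInterval) (j : Fin n) : ℝ :=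
  min (q j : ℝ) (1 - (q j : ℝ))

/-- The causal parameter `m = max {j | q_(j) < 1 / j}`, where `q_(1) ≤ … ≤ q_(n)` are the
probabilities of the rarer values of the variables, in increasing order
(the index `j : Fin n` stands for `j + 1`). -/
noncomputable def causalParam {n : ℕ} (q : Fin n → unitInterval) : ℕ :=
  (Finset.univ.filter fun j : Fin n =>
      lesserProb q (Tuple.sort (lesserProb q) j) < 1 / ((j : ℝ) + 1)).sup
    fun j => (j : ℕ) + 1

/-- Reward distributions: `r i x` is the probability of reward `1` when the MDP leaves the
intermediate state `i` and the variables there have the values `x`. -/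
abbrev Rewards (n k : ℕ) : Type := Fin k → Realization n → unitInterval

/-- A two-stage causal MDP with `k` intermediate states and `n` variables at each state:
the success probabilities of the variables at the start state and at the intermediate states,
the law of the next state given the variables at the start state, and the reward distributions. -/
structure CausalMDP (n k : ℕ) where
  q0 : Fin n → unitInterval
  trans : Realization n → PMF (Fin k)
  q : Fin k → Fin n → unitInterval
  rew : Rewards n k

/-- A policy: an intervention at the start state, and one at each intermediate state. -/
abbrev Policy (n k : ℕ) : Type := Intervention n × (Fin k → Intervention n)

/-- What is observed in one round: the intervention performed at the start state, the variables
there, the intermediate state reached, the intervention performed there, the variables there,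
and the reward. -/
structure Round (n k : ℕ) where
  act0 : Intervention n
  obs0 : Realization n
  state : Fin k
  act : Intervention n
  obs : Realization n
  reward : Bool

/-- A (randomized, adaptive) algorithm. A history is the list of the past rounds, latest first.
The algorithm picks the intervention at the start state from the history, the intervention at the
intermediate state from the history and the observations made so far in the current round, and
the returned policy from the final history. -/
structure Algorithm (n k : ℕ) where
  first : List (Round n k) → PMF (Intervention n)
  second : List (Round n k) → Intervention n → Realization n → Fin k → PMF (Intervention n)
  output : List (Round n k) → PMF (Policy n k)

namespace CausalMDP

variable {n k : ℕ} (M : CausalMDP n k)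

/-- The transition matrix: `M.P a i` is the probability of moving to `i` when `a` is performed
at the start state. -/
noncomputable def P (a : Intervention n) (i : Fin k) : ℝ≥0∞ :=
  ((varLaw M.q0 a).bind M.trans) i

/-- The smallest nonzero transition probability. -/
noncomputable def pPlus : ℝ≥0∞ :=
  sInf {p | p ≠ 0 ∧ ∃ a i, M.P a i = p}

/-- The causal parameter at the start state. -/
noncomputable def m0 : ℕ := causalParam M.q0

/-- The causal parameter at the intermediate state `i`. -/
noncomputable def m (i : Fin k) : ℕ := causalParam (M.q i)

/-- `‖P M^(1/2) (Pᵀ f)^(∘ -1/2)‖_∞²` for a frequency vector `f`, computed in `[0, ∞]` with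
`0 ^ (-1/2) = ∞` and `0 * ∞ = 0`. -/
noncomputable def lamObjective (f : PMF (Intervention n)) : ℝ≥0∞ :=
  (⨆ a, ∑ i, M.P a i * (M.m i : ℝ≥0∞) ^ (1 / 2 : ℝ) *
    (∑ b, M.P b i * f b) ^ (-(1 / 2) : ℝ)) ^ 2

/-- The parameter `λ`: the minimum of the objective over all frequency vectors. -/
noncomputable def lam : ℝ≥0∞ := ⨅ f, M.lamObjective f

/-- The expected reward `E[R_i | a]`. -/
noncomputable def expReward (i : Fin k) (a : Intervention n) : ℝ :=
  ∑ x, (varLaw (M.q i) a x).toReal * (M.rew i x : ℝ)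

/-- The expected reward of a policy. -/
noncomputable def value (π : Policy n k) : ℝ :=
  ∑ i, (M.P π.1 i).toReal * M.expReward i (π.2 i)

/-- The sub-optimality `ε(π)`: the expected reward of an optimal policy minus that of `π`. -/
noncomputable def subopt (π : Policy n k) : ℝ := (⨆ π', M.value π') - M.value π

/-- The law of the next round when algorithm `A` has seen the history `h`. -/
noncomputable def roundLaw (A : Algorithm n k) (h : List (Round n k)) : PMF (Round n k) :=
  (A.first h).bind fun a =>
  (varLaw M.q0 a).bind fun x0 =>
  (M.trans x0).bind fun i =>
  (A.second h a x0 i).bind fun b =>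
  (varLaw (M.q i) b).bind fun x =>
  (coin (M.rew i x)).bind fun r =>
  PMF.pure ⟨a, x0, i, b, x, r⟩

/-- The law of the history after `T` rounds. -/
noncomputable def historyLaw (A : Algorithm n k) : ℕ → PMF (List (Round n k))
  | 0 => PMF.pure []
  | T + 1 => (historyLaw A T).bind fun h => (M.roundLaw A h).map fun ρ => ρ :: h

/-- The law of the policy returned after `T` rounds. -/
noncomputable def outputLaw (A : Algorithm n k) (T : ℕ) : PMF (Policy n k) :=
  (M.historyLaw A T).bind A.output

/-- The simple regret `Regret_T = E[ε(π̂)]` of algorithm `A` with time budget `T`. -/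
noncomputable def regret (A : Algorithm n k) (T : ℕ) : ℝ :=
  ∑ π, (M.outputLaw A T π).toReal * M.subopt π

end CausalMDP

/-! Take all start variables equal to `0` by default: `do(X_j = 1)` then leads surely to state `j`
and every other intervention to the last state, so `P` is deterministic and every state can be
reached at will. If `F` is the law of the state under `f`, the objective becomes the maximum of `m_i
/ F_i`. As the `F_i` sum to one, this is at least `∑ m_i`, with equality for `F` proportional to `m`
(`isLeast_lamObjective`).

For the regret, each state has `m_i` variables whose rarer value has probability at most `1 / m_i`
(`exists_rare_finset`). Start from fair-coin rewards and hide a bias `δ` on one of these `L = ∑ m_i`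
pairs of a state and a rare value. A policy that does not go to that state and force that value
loses at least `δ / 2` (`subopt_spiked_ge`). One intervention produces on average at most two of the
rare values (`sum_coordLaw_rareValue_le`), so under fair rewards `T` rounds share at most `2 T`
expected hits among `L` spikes. A spike raises the probability of an event by at most `1 / 8 + 24
δ²` times its expected number of hits (`expect_historyLaw_spiked_le`). With `δ²` of order `min(1, L
/ T)`, averaging over the spikes (`sum_expect_good_le`) yields one that the algorithm misses with
probability at least `1 / 4`. -/

/-! ### Expectations under discrete laws -/

namespace PMF

variable {α β : Type*}

/-- The expectation of a `[0, ∞]`-valued function under a discrete law. -/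
noncomputable def expect (p : PMF α) (f : α → ℝ≥0∞) : ℝ≥0∞ := ∑' x, p x * f x

theorem expect_pure (a : α) (f : α → ℝ≥0∞) : (pure a).expect f = f a := by
  classical
  rw [expect, tsum_eq_single a]
  · simp
  · intro b hb
    simp [pure_apply, hb]

theorem expect_bind (p : PMF α) (g : α → PMF β) (f : β → ℝ≥0∞) :
    (p.bind g).expect f = p.expect fun a => (g a).expect f := by
  simp only [expect, bind_apply, ← ENNReal.tsum_mul_right, ← ENNReal.tsum_mul_left, mul_assoc]
  exact ENNReal.tsum_comm

theorem expect_map (p : PMF α) (g : α → β) (f : β → ℝ≥0∞) :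
    (p.map g).expect f = p.expect fun a => f (g a) := by
  rw [map, expect_bind]
  simp only [Function.comp_apply, expect_pure]

theorem expect_const (p : PMF α) (c : ℝ≥0∞) : (p.expect fun _ => c) = c := by
  rw [expect, ENNReal.tsum_mul_right, p.tsum_coe, one_mul]

theorem expect_add (p : PMF α) (f g : α → ℝ≥0∞) :
    (p.expect fun x => f x + g x) = p.expect f + p.expect g := by
  simp only [expect, mul_add, ENNReal.tsum_add]

theorem expect_const_mul (p : PMF α) (c : ℝ≥0∞) (f : α → ℝ≥0∞) :
    (p.expect fun x => c * f x) = c * p.expect f := by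
  simp only [expect, ← ENNReal.tsum_mul_left, mul_left_comm]

theorem expect_mono (p : PMF α) {f g : α → ℝ≥0∞} (h : ∀ x, f x ≤ g x) :
    p.expect f ≤ p.expect g :=
  ENNReal.tsum_le_tsum fun x => mul_le_mul_right (h x) _

theorem expect_le_const (p : PMF α) {f : α → ℝ≥0∞} {c : ℝ≥0∞} (h : ∀ x, f x ≤ c) :
    p.expect f ≤ c :=
  (p.expect_mono h).trans (p.expect_const c).le

theorem expect_finset_sum {ι : Type*} (p : PMF α) (s : Finset ι) (f : ι → α → ℝ≥0∞) :
    (p.expect fun x => ∑ i ∈ s, f i x) = ∑ i ∈ s, p.expect (f i) := by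
  classical
  induction s using Finset.induction_on with
  | empty => simp [expect]
  | insert i s hi ih => simp only [Finset.sum_insert hi, expect_add, ih]

theorem expect_eq_sum [Fintype α] (p : PMF α) (f : α → ℝ≥0∞) :
    p.expect f = ∑ x, p x * f x :=
  tsum_fintype _

end PMF

/-! ### Bernoulli variables and their rare values -/

theorem coin_true (p : unitInterval) : coin p true = ENNReal.ofReal (p : ℝ) := rfl

theorem coin_false (p : unitInterval) : coin p false = ENNReal.ofReal (1 - (p : ℝ)) := rfl

theorem coin_zero : coin 0 = PMF.pure false := by
  ext b
  cases b <;> simp [coin_true, coin_false, PMF.pure_apply]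

/-- The number `1 / 2` in the unit interval. -/
noncomputable def unitHalf : unitInterval := ⟨1 / 2, by norm_num, by norm_num⟩

theorem coe_unitHalf : (unitHalf : ℝ) = 1 / 2 := rfl

theorem expect_coin (p : unitInterval) (f : Bool → ℝ≥0∞) :
    (coin p).expect f =
      ENNReal.ofReal (p : ℝ) * f true + ENNReal.ofReal (1 - (p : ℝ)) * f false := by
  rw [PMF.expect_eq_sum, Fintype.sum_bool, coin_true, coin_false]

section Variables

variable {n : ℕ}

theorem varLaw_apply (q : Fin n → unitInterval) (a : Intervention n) (x : Realization n) :
    varLaw q a x = ∏ j, coordLaw q a j (x j) := rfl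

/-- Putting the indicator into the `j`-th factor keeps the product form, so the sum over
realizations factors, and the other factors sum to one. -/
theorem varLaw_marginal (q : Fin n → unitInterval) (a : Intervention n) (j : Fin n) (b : Bool) :
    ((varLaw q a).expect fun x => if x j = b then 1 else 0) = coordLaw q a j b := by
  have h := Finset.prod_univ_sum (fun _ : Fin n => (Finset.univ : Finset Bool))
    (fun i c => coordLaw q a i c * if i = j then (if c = b then 1 else 0) else 1)
  rw [Fintype.piFinset_univ] at h
  rw [PMF.expect_eq_sum]
  have e : ∀ x : Realization n, varLaw q a x * (if x j = b then 1 else 0) =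
      ∏ i, (coordLaw q a i (x i) * if i = j then (if x i = b then 1 else 0) else 1) := by
    intro x
    rw [Finset.prod_mul_distrib, varLaw_apply]
    congr 1
    rw [Finset.prod_ite_eq' Finset.univ j fun i => if x i = b then (1 : ℝ≥0∞) else 0]
    simp
  rw [Finset.sum_congr rfl fun x _ => e x, ← h, Finset.prod_eq_single j]
  · simp
  · intro i _ hi
    simp only [hi, if_false, mul_one]
    rw [← tsum_fintype (L := .unconditional Bool)]
    exact (coordLaw q a i).tsum_coe
  · simp

/-- The rarer value of the variable `X_j`. -/
noncomputable def rareValue (q : Fin n → unitInterval) (j : Fin n) : Bool :=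
  if (q j : ℝ) ≤ 1 / 2 then true else false

theorem coin_rareValue (q : Fin n → unitInterval) (j : Fin n) :
    coin (q j) (rareValue q j) = ENNReal.ofReal (lesserProb q j) := by
  unfold rareValue lesserProb
  split_ifs with h
  · rw [coin_true, min_eq_left (by linarith)]
  · rw [coin_false, min_eq_right (by linarith)]

theorem lesserProb_le_half (q : Fin n → unitInterval) (j : Fin n) : lesserProb q j ≤ 1 / 2 := by
  unfold lesserProb
  rcases le_total (q j : ℝ) (1 / 2) with h | h
  · exact (min_le_left _ _).trans h
  · exact (min_le_right _ _).trans (by linarith)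

theorem coordLaw_self (q : Fin n → unitInterval) (j : Fin n) (b : Bool) :
    coordLaw q (some (j, b)) j b = 1 := by
  simp [coordLaw]

theorem coordLaw_of_ne (q : Fin n → unitInterval) {a : Intervention n} {j : Fin n} {b : Bool}
    (h : a ≠ some (j, b)) : coordLaw q a j b ≤ coin (q j) b := by
  match a with
  | none => exact le_rfl
  | some (j', b') =>
    by_cases hj : j' = j
    · subst hj
      have hb : b ≠ b' := fun e => h (by rw [e])
      simp [coordLaw, PMF.pure_apply, hb]
    · simp [coordLaw, hj]

theorem causalParam_le (q : Fin n → unitInterval) : causalParam q ≤ n :=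
  Finset.sup_le fun j _ => j.2

theorem one_le_causalParam (hn : 0 < n) (q : Fin n → unitInterval) : 1 ≤ causalParam q := by
  have hmem : (⟨0, hn⟩ : Fin n) ∈ Finset.univ.filter fun j : Fin n =>
      lesserProb q (Tuple.sort (lesserProb q) j) < 1 / ((j : ℝ) + 1) := by
    rw [Finset.mem_filter]
    refine ⟨Finset.mem_univ _, (lesserProb_le_half q _).trans_lt ?_⟩
    norm_num
  exact Finset.le_sup (f := fun j : Fin n => (j : ℕ) + 1) hmem

/-- The set is the initial segment of the sorted order up to the index attaining the maximum in
`causalParam`; monotonicity carries the bound there to all earlier indices. -/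
theorem exists_rare_finset (hn : 0 < n) (q : Fin n → unitInterval) :
    ∃ J : Finset (Fin n), J.card = causalParam q ∧
      ∀ j ∈ J, lesserProb q j ≤ 1 / (causalParam q : ℝ) := by
  set σ := Tuple.sort (lesserProb q) with hσ
  set S := Finset.univ.filter fun j : Fin n => lesserProb q (σ j) < 1 / ((j : ℝ) + 1) with hS
  have hm : causalParam q = S.sup fun j => (j : ℕ) + 1 := rfl
  have hne : S.Nonempty := by
    rw [Finset.nonempty_iff_ne_empty]
    intro h0
    have := one_le_causalParam hn q
    rw [hm, h0] at this
    simp at this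
  obtain ⟨j₀, hj₀, hsup⟩ := Finset.exists_mem_eq_sup S hne fun j => (j : ℕ) + 1
  rw [← hm] at hsup
  have hlt : lesserProb q (σ j₀) < 1 / ((j₀ : ℝ) + 1) := (Finset.mem_filter.1 hj₀).2
  refine ⟨(Finset.Iic j₀).map σ.toEmbedding, ?_, ?_⟩
  · rw [Finset.card_map, Fin.card_Iic, hsup]
  · intro j hj
    obtain ⟨i, hi, rfl⟩ := Finset.mem_map.1 hj
    have hmono := Tuple.monotone_sort (lesserProb q) (Finset.mem_Iic.1 hi)
    rw [hsup]
    push_cast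
    exact hmono.trans hlt.le

/-- By default the rare values contribute at most `|J| · 1 / |J|` in total, and an intervention
forces at most one of them, adding at most one. -/
theorem sum_coordLaw_rareValue_le (q : Fin n → unitInterval) (J : Finset (Fin n))
    (hJ : ∀ j ∈ J, lesserProb q j ≤ 1 / (J.card : ℝ)) (a : Intervention n) :
    ∑ j ∈ J, coordLaw q a j (rareValue q j) ≤ 2 := by
  classical
  have hle : ∀ j ∈ J, coordLaw q a j (rareValue q j) ≤
      (J.card : ℝ≥0∞)⁻¹ + if a = some (j, rareValue q j) then 1 else 0 := by
    intro j hj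
    split_ifs with h
    · rw [h, coordLaw_self]
      exact le_add_self
    · rw [add_zero]
      refine (coordLaw_of_ne q h).trans ?_
      rw [coin_rareValue]
      have hpos : 0 < J.card := Finset.card_pos.2 ⟨j, hj⟩
      refine (ENNReal.ofReal_le_ofReal (hJ j hj)).trans ?_
      rw [one_div, ENNReal.ofReal_inv_of_pos (by exact_mod_cast hpos), ENNReal.ofReal_natCast]
  refine (Finset.sum_le_sum hle).trans ?_
  rw [Finset.sum_add_distrib, Finset.sum_const, nsmul_eq_mul, ← one_add_one_eq_two]
  refine add_le_add (ENNReal.mul_inv_le_one _) ?_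
  rw [Finset.sum_ite, Finset.sum_const_zero, add_zero, Finset.sum_const, nsmul_eq_mul, mul_one]
  have : (J.filter fun j => a = some (j, rareValue q j)).card ≤ 1 := by
    refine Finset.card_le_one.2 fun i hi j hj => ?_
    have := (Finset.mem_filter.1 hi).2.symm.trans (Finset.mem_filter.1 hj).2
    simpa using congrArg (Option.map Prod.fst) this
  exact_mod_cast this

end Variables

/-! ### Expectations over histories -/

namespace CausalMDP

variable {n k : ℕ} (M : CausalMDP n k)

theorem expect_roundLaw (A : Algorithm n k) (h : List (Round n k)) (f : Round n k → ℝ≥0∞) :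
    (M.roundLaw A h).expect f =
      (A.first h).expect fun a => (varLaw M.q0 a).expect fun x0 => (M.trans x0).expect fun i =>
      (A.second h a x0 i).expect fun b => (varLaw (M.q i) b).expect fun x =>
      (coin (M.rew i x)).expect fun r => f ⟨a, x0, i, b, x, r⟩ := by
  simp only [roundLaw, PMF.expect_bind, PMF.expect_pure]

theorem expect_historyLaw_zero (A : Algorithm n k) (f : List (Round n k) → ℝ≥0∞) :
    (M.historyLaw A 0).expect f = f [] :=
  PMF.expect_pure _ _

theorem expect_historyLaw_succ (A : Algorithm n k) (T : ℕ) (f : List (Round n k) → ℝ≥0∞) :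
    (M.historyLaw A (T + 1)).expect f =
      (M.historyLaw A T).expect fun h => (M.roundLaw A h).expect fun ρ => f (ρ :: h) := by
  simp only [historyLaw, PMF.expect_bind, PMF.expect_map]

theorem expect_historyLaw_sum_mono (A : Algorithm n k) (T : ℕ) {φ ψ : Round n k → ℝ≥0∞}
    (H : ∀ h, (M.roundLaw A h).expect φ ≤ (M.roundLaw A h).expect ψ) :
    ((M.historyLaw A T).expect fun h => (h.map φ).sum) ≤
      (M.historyLaw A T).expect fun h => (h.map ψ).sum := by
  induction T with
  | zero => simp [expect_historyLaw_zero]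
  | succ T ih =>
    simp only [expect_historyLaw_succ, List.map_cons, List.sum_cons, PMF.expect_add,
      PMF.expect_const]
    exact add_le_add (PMF.expect_mono _ H) ih

theorem expect_historyLaw_sum_le (A : Algorithm n k) (T : ℕ) {φ : Round n k → ℝ≥0∞} {C : ℝ≥0∞}
    (H : ∀ h, (M.roundLaw A h).expect φ ≤ C) :
    ((M.historyLaw A T).expect fun h => (h.map φ).sum) ≤ T * C := by
  induction T with
  | zero => simp [expect_historyLaw_zero]
  | succ T ih =>
    simp only [expect_historyLaw_succ, List.map_cons, List.sum_cons, PMF.expect_add,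
      PMF.expect_const]
    rw [Nat.cast_succ, add_mul, one_mul, add_comm]
    exact add_le_add ih (PMF.expect_le_const _ H)

/-- Likelihood ratios of single rounds multiply along the history. The hypothesis is needed after
every history because play is adaptive. -/
theorem expect_historyLaw_change (M' : CausalMDP n k) (A : Algorithm n k)
    (w : Round n k → ℝ≥0∞)
    (H : ∀ h f, (M'.roundLaw A h).expect f = (M.roundLaw A h).expect fun ρ => w ρ * f ρ)
    (T : ℕ) (f : List (Round n k) → ℝ≥0∞) :
    (M'.historyLaw A T).expect f =
      (M.historyLaw A T).expect fun h => (h.map w).prod * f h := by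
  induction T generalizing f with
  | zero => simp [expect_historyLaw_zero]
  | succ T ih =>
    rw [expect_historyLaw_succ, ih, expect_historyLaw_succ]
    congr 1
    ext h
    rw [H, ← PMF.expect_const_mul]
    congr 1
    ext ρ
    rw [List.map_cons, List.prod_cons]
    ring

theorem expect_outputLaw (A : Algorithm n k) (T : ℕ) (f : Policy n k → ℝ≥0∞) :
    (M.outputLaw A T).expect f = (M.historyLaw A T).expect fun h => (A.output h).expect f :=
  PMF.expect_bind _ _ _

end CausalMDP

/-! ### Change of measure between fair and spiked rewards -/

/-- A pointwise substitute for Pinsker's inequality: `(l - 1) g ≤ 8 (l - 1 - log l) + (l + 1) / 16`.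
For a likelihood ratio `l`, of mean one, the expectation of the right side is `8` times the relative
entropy plus `1 / 8`. The terms are arranged so that only `log l` can be negative. -/
theorem mul_likelihood_le {l g : ℝ} (hl : 0 < l) (hg0 : 0 ≤ g) (hg1 : g ≤ 1) :
    l * g + 8 + 8 * Real.log l ≤ g + 8 * l + (l + 1) / 16 := by
  have hs : 0 < √l := Real.sqrt_pos.2 hl
  have hsq : √l ^ 2 = l := Real.sq_sqrt hl.le
  have hlog : Real.log l ≤ 2 * (√l - 1) := by
    have h1 := Real.log_le_sub_one_of_pos hs
    rw [Real.log_sqrt hl.le] at h1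
    linarith
  generalize √l = s at *
  subst hsq
  rcases le_total 1 s with h | h
  · have : 0 ≤ (1 - g) * (s ^ 2 - 1) := mul_nonneg (by linarith) (by nlinarith)
    -- AM-GM gives `(s - 1)(s + 1) ≤ 8 (s - 1)² + (s + 1)² / 32`, and `(s + 1)² ≤ 2 (s² + 1)`.
    nlinarith [sq_nonneg (s - 1 - (s + 1) / 16)]
  · have : 0 ≤ g * (1 - s ^ 2) := mul_nonneg hg0 (by nlinarith)
    nlinarith [sq_nonneg (s - 1), sq_nonneg s]

section Spike

variable {n k : ℕ}

/-- Rewards that are fair coins, except that the success probability is `p` at the state `i₀`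
when `X_j = b`. -/
noncomputable def spikedRewards (p : unitInterval) (i₀ : Fin k) (j : Fin n) (b : Bool) :
    Rewards n k :=
  fun i x => if i = i₀ ∧ x j = b then p else unitHalf

/-- The round visits the state `i₀` with `X_j = b` there. -/
abbrev Round.Hits (i₀ : Fin k) (j : Fin n) (b : Bool) (ρ : Round n k) : Prop :=
  ρ.state = i₀ ∧ ρ.obs j = b

/-- The likelihood ratio of a round for the spiked rewards against fair coins. -/
noncomputable def spikeRatio (p : unitInterval) (i₀ : Fin k) (j : Fin n) (b : Bool)
    (ρ : Round n k) : ℝ≥0∞ :=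
  if ρ.Hits i₀ j b then 2 * coin p ρ.reward else 1

/-- The positive part of the logarithm of `spikeRatio`. -/
noncomputable def spikeGain (p : unitInterval) (i₀ : Fin k) (j : Fin n) (b : Bool)
    (ρ : Round n k) : ℝ≥0∞ :=
  if ρ.Hits i₀ j b ∧ ρ.reward = true then ENNReal.ofReal (Real.log (2 * p)) else 0

/-- The negative part of the logarithm of `spikeRatio`. -/
noncomputable def spikeLoss (p : unitInterval) (i₀ : Fin k) (j : Fin n) (b : Bool)
    (ρ : Round n k) : ℝ≥0∞ :=
  if ρ.Hits i₀ j b ∧ ρ.reward = false then ENNReal.ofReal (-Real.log (2 * (1 - p))) else 0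

/-- Only the reward law changes, and a fair coin gives each value mass `1 / 2`; hence the factor `2`
in the ratio. -/
theorem expect_roundLaw_spiked (q0 : Fin n → unitInterval) (trans : Realization n → PMF (Fin k))
    (q : Fin k → Fin n → unitInterval) (p : unitInterval) (i₀ : Fin k) (j : Fin n) (b : Bool)
    (A : Algorithm n k) (h : List (Round n k)) (f : Round n k → ℝ≥0∞) :
    ((⟨q0, trans, q, spikedRewards p i₀ j b⟩ : CausalMDP n k).roundLaw A h).expect f =
      ((⟨q0, trans, q, fun _ _ => unitHalf⟩ : CausalMDP n k).roundLaw A h).expect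
        fun ρ => spikeRatio p i₀ j b ρ * f ρ := by
  simp only [CausalMDP.expect_roundLaw]
  congr! 10 with a x0 i c x
  unfold spikedRewards spikeRatio
  by_cases hh : i = i₀ ∧ x j = b
  · have h2 : ENNReal.ofReal (1 / 2) * 2 = 1 := by
      rw [← ENNReal.ofReal_ofNat 2, ← ENNReal.ofReal_mul (by norm_num)]
      norm_num
    have h2' : ∀ u v : ℝ≥0∞, ENNReal.ofReal (1 / 2) * (2 * u * v) = u * v := by
      intro u v
      rw [mul_assoc, ← mul_assoc, h2, one_mul]
    have h3 : (1 : ℝ) - 1 / 2 = 1 / 2 := by norm_num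
    simp only [Round.Hits, hh, and_self, if_true, expect_coin, coin_true, coin_false,
      coe_unitHalf, h3, h2']
  · simp only [Round.Hits, hh, if_false, one_mul]

/-- With `δ = p - 1 / 2` the two logarithms add up to `log (1 - 4 δ²) ≥ -4 δ² / (1 - 4 δ²)`, and `4
δ² ≤ 1 / 4`. -/
theorem spike_log_bound {p : ℝ} (h0 : 1 / 2 ≤ p) (h1 : p ≤ 3 / 4) :
    -Real.log (2 * (1 - p)) ≤ Real.log (2 * p) + 6 * (p - 1 / 2) ^ 2 := by
  have hpos : 0 < 2 * (1 - p) * (2 * p) := mul_pos (by linarith) (by linarith)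
  have h := Real.one_sub_inv_le_log_of_pos hpos
  rw [Real.log_mul (by linarith) (by linarith)] at h
  have : (2 * (1 - p) * (2 * p))⁻¹ ≤ 1 + 6 * (p - 1 / 2) ^ 2 := by
    rw [inv_le_iff_one_le_mul₀ hpos]
    have e : 2 * (1 - p) * (2 * p) = 1 - 4 * (p - 1 / 2) ^ 2 := by ring
    rw [e]
    have hd : (p - 1 / 2) ^ 2 ≤ 1 / 16 := by nlinarith
    nlinarith [sq_nonneg (p - 1 / 2)]
  linarith

/-- The relative entropy of one round. On a hit, a fair reward gives weight `1 / 2` to the loss and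
to the gain, which halves the `6 δ²` of `spike_log_bound`. -/
theorem expect_roundLaw_spikeLoss_le (M : CausalMDP n k) (hM : ∀ i x, M.rew i x = unitHalf)
    {p : unitInterval} (h0 : 1 / 2 ≤ (p : ℝ)) (h1 : (p : ℝ) ≤ 3 / 4)
    (i₀ : Fin k) (j : Fin n) (b : Bool) (A : Algorithm n k) (h : List (Round n k)) :
    (M.roundLaw A h).expect (spikeLoss p i₀ j b) ≤
      (M.roundLaw A h).expect fun ρ => spikeGain p i₀ j b ρ +
        ENNReal.ofReal (3 * ((p : ℝ) - 1 / 2) ^ 2) * if ρ.Hits i₀ j b then 1 else 0 := by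
  simp only [CausalMDP.expect_roundLaw]
  refine PMF.expect_mono _ fun a => PMF.expect_mono _ fun x0 => PMF.expect_mono _ fun i =>
    PMF.expect_mono _ fun c => PMF.expect_mono _ fun x => ?_
  rw [hM, PMF.expect_add]
  unfold spikeLoss spikeGain
  by_cases hh : i = i₀ ∧ x j = b
  · have h3 : (1 : ℝ) - 1 / 2 = 1 / 2 := by norm_num
    have hlog : 0 ≤ Real.log (2 * p) := Real.log_nonneg (by linarith)
    have key := spike_log_bound h0 h1
    simp only [Round.Hits, hh, and_self, true_and, if_true, expect_coin, coe_unitHalf, h3, mul_one,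
      Bool.false_eq_true, Bool.true_eq_false, if_false, mul_zero, zero_add, add_zero]
    rw [← ENNReal.ofReal_mul (by norm_num), ← ENNReal.ofReal_mul (by norm_num),
      ← ENNReal.ofReal_mul (by norm_num), ← ENNReal.ofReal_add (by positivity) (by positivity),
      ← ENNReal.ofReal_add (by positivity) (by positivity)]
    exact ENNReal.ofReal_le_ofReal (by linarith)
  · simp [Round.Hits, hh, PMF.expect_const]

/-- The log-likelihood ratio is split into nonnegative parts so that all expectations can be taken
in `[0, ∞]`; the real numbers `l`, `u`, `v` recover the identity `log l = u - v` on each history. -/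
theorem spike_list_real {p : unitInterval} (h0 : 1 / 2 ≤ (p : ℝ)) (h1 : (p : ℝ) ≤ 3 / 4)
    (i₀ : Fin k) (j : Fin n) (b : Bool) (h : List (Round n k)) :
    ∃ l u v : ℝ, 0 < l ∧ 0 ≤ u ∧ 0 ≤ v ∧ Real.log l = u - v ∧
      (h.map (spikeRatio p i₀ j b)).prod = ENNReal.ofReal l ∧
      (h.map (spikeGain p i₀ j b)).sum = ENNReal.ofReal u ∧
      (h.map (spikeLoss p i₀ j b)).sum = ENNReal.ofReal v := by
  induction h with
  | nil => exact ⟨1, 0, 0, by simp⟩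
  | cons ρ h ih =>
    obtain ⟨l, u, v, hl, hu, hv, hlog, el, eu, ev⟩ := ih
    simp only [List.map_cons, List.prod_cons, List.sum_cons, el, eu, ev]
    have hg : 0 ≤ Real.log (2 * p) := Real.log_nonneg (by linarith)
    have hs : 0 ≤ -Real.log (2 * (1 - p)) :=
      neg_nonneg.2 (Real.log_nonpos (by linarith) (by linarith))
    have two : (2 : ℝ≥0∞) = ENNReal.ofReal 2 := by simp
    unfold spikeRatio spikeGain spikeLoss
    by_cases hh : ρ.Hits i₀ j b
    · cases hr : ρ.reward
      · refine ⟨2 * (1 - p) * l, u, -Real.log (2 * (1 - p)) + v,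
          mul_pos (by linarith) hl, hu, by positivity, ?_, ?_, ?_, ?_⟩
        · rw [Real.log_mul (by linarith) hl.ne', hlog]
          ring
        · rw [if_pos hh, coin_false, two, ← ENNReal.ofReal_mul (by norm_num),
            ← ENNReal.ofReal_mul (by linarith)]
        · simp
        · rw [if_pos ⟨hh, rfl⟩, ENNReal.ofReal_add hs hv]
      · refine ⟨2 * p * l, Real.log (2 * p) + u, v,
          mul_pos (by linarith) hl, by positivity, hv, ?_, ?_, ?_, ?_⟩
        · rw [Real.log_mul (by linarith) hl.ne', hlog]
          ring
        · rw [if_pos hh, coin_true, two, ← ENNReal.ofReal_mul (by norm_num),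
            ← ENNReal.ofReal_mul (by linarith)]
        · rw [if_pos ⟨hh, rfl⟩, ENNReal.ofReal_add hg hu]
        · simp
    · exact ⟨l, u, v, hl, hu, hv, hlog, by simp [hh], by simp [hh], by simp [hh]⟩

theorem spike_list_le {p : unitInterval} (h0 : 1 / 2 ≤ (p : ℝ)) (h1 : (p : ℝ) ≤ 3 / 4)
    (i₀ : Fin k) (j : Fin n) (b : Bool) (h : List (Round n k)) {g : ℝ≥0∞} (hg : g ≤ 1) :
    (h.map (spikeRatio p i₀ j b)).prod * g + 8 + 8 * (h.map (spikeGain p i₀ j b)).sum ≤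
      g + 8 * (h.map (spikeRatio p i₀ j b)).prod +
        16⁻¹ * ((h.map (spikeRatio p i₀ j b)).prod + 1) +
        8 * (h.map (spikeLoss p i₀ j b)).sum := by
  obtain ⟨l, u, v, hl, hu, hv, hlog, el, eu, ev⟩ := spike_list_real h0 h1 i₀ j b h
  rw [el, eu, ev]
  have hgt : g ≠ ⊤ := ne_top_of_le_ne_top ENNReal.one_ne_top hg
  have key := mul_likelihood_le hl ENNReal.toReal_nonneg
    (ENNReal.toReal_mono ENNReal.one_ne_top hg)
  rw [← ENNReal.ofReal_toReal hgt]
  have hg0 := ENNReal.toReal_nonneg (a := g)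
  generalize g.toReal = g' at *
  have e8 : (8 : ℝ≥0∞) = ENNReal.ofReal 8 := by simp
  have e16 : (16 : ℝ≥0∞)⁻¹ = ENNReal.ofReal (1 / 16) := by
    rw [one_div, ENNReal.ofReal_inv_of_pos (by norm_num)]
    simp
  rw [e8, e16, ← ENNReal.ofReal_one, ← ENNReal.ofReal_mul hl.le,
    ← ENNReal.ofReal_add (by positivity) (by positivity),
    ← ENNReal.ofReal_mul (by positivity), ← ENNReal.ofReal_mul (by positivity),
    ← ENNReal.ofReal_mul (by positivity), ← ENNReal.ofReal_add (by positivity) (by positivity),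
    ← ENNReal.ofReal_add (by positivity) (by positivity),
    ← ENNReal.ofReal_add (by positivity) (by positivity),
    ← ENNReal.ofReal_mul (by positivity), ← ENNReal.ofReal_add (by positivity) (by positivity),
    ← ENNReal.ofReal_add (by positivity) (by positivity)]
  refine ENNReal.ofReal_le_ofReal ?_
  rw [hlog] at key
  linarith

/-- Probabilities of events under spiked and under fair rewards differ little if few rounds are
expected to hit the spike. -/
theorem expect_historyLaw_spiked_le (q0 : Fin n → unitInterval)
    (trans : Realization n → PMF (Fin k)) (q : Fin k → Fin n → unitInterval)
    {p : unitInterval} (h0 : 1 / 2 ≤ (p : ℝ)) (h1 : (p : ℝ) ≤ 3 / 4)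
    (i₀ : Fin k) (j : Fin n) (b : Bool) (A : Algorithm n k) (T : ℕ)
    {g : List (Round n k) → ℝ≥0∞} (hg : ∀ h, g h ≤ 1) :
    ((⟨q0, trans, q, spikedRewards p i₀ j b⟩ : CausalMDP n k).historyLaw A T).expect g ≤
      ((⟨q0, trans, q, fun _ _ => unitHalf⟩ : CausalMDP n k).historyLaw A T).expect g + 8⁻¹ +
      ENNReal.ofReal (24 * ((p : ℝ) - 1 / 2) ^ 2) *
        ((⟨q0, trans, q, fun _ _ => unitHalf⟩ : CausalMDP n k).historyLaw A T).expect
          fun h => (h.map fun ρ => if ρ.Hits i₀ j b then (1 : ℝ≥0∞) else 0).sum := by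
  set M₀ : CausalMDP n k := ⟨q0, trans, q, fun _ _ => unitHalf⟩ with hM₀
  set M₁ : CausalMDP n k := ⟨q0, trans, q, spikedRewards p i₀ j b⟩ with hM₁
  have change := fun f => CausalMDP.expect_historyLaw_change M₀ M₁ A (spikeRatio p i₀ j b)
    (fun h f => expect_roundLaw_spiked q0 trans q p i₀ j b A h f) T f
  have total : ((M₀.historyLaw A T).expect fun h => (h.map (spikeRatio p i₀ j b)).prod) = 1 := by
    have := change fun _ => 1
    simp only [mul_one] at this
    rw [← this, PMF.expect_const]
  have main := (M₀.historyLaw A T).expect_mono fun h => spike_list_le h0 h1 i₀ j b h (hg h)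
  simp only [PMF.expect_add, PMF.expect_const_mul, PMF.expect_const, total] at main
  rw [← change] at main
  have loss := M₀.expect_historyLaw_sum_mono A T
    (expect_roundLaw_spikeLoss_le M₀ (fun _ _ => rfl) h0 h1 i₀ j b A)
  simp only [List.sum_map_add, List.sum_map_mul_left, PMF.expect_add,
    PMF.expect_const_mul] at loss
  -- The expected gain occurs on both sides of the final inequality and is cancelled, which requires
  -- it to be finite.
  have gain : ((M₀.historyLaw A T).expect fun h => (h.map (spikeGain p i₀ j b)).sum) ≠ ⊤ := by
    refine ne_top_of_le_ne_top ?_ (M₀.expect_historyLaw_sum_le A T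
      (C := ENNReal.ofReal (Real.log (2 * p))) fun h => PMF.expect_le_const _ fun ρ => ?_)
    · exact ENNReal.mul_ne_top (ENNReal.natCast_ne_top _) ENNReal.ofReal_ne_top
    · unfold spikeGain
      split_ifs
      exacts [le_rfl, zero_le]
  have e24 : ENNReal.ofReal (24 * ((p : ℝ) - 1 / 2) ^ 2) =
      8 * ENNReal.ofReal (3 * ((p : ℝ) - 1 / 2) ^ 2) := by
    rw [← ENNReal.ofReal_ofNat 8, ← ENNReal.ofReal_mul (by norm_num)]
    congr 1
    ring
  have e16 : (16 : ℝ≥0∞)⁻¹ * (1 + 1) = 8⁻¹ := by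
    rw [show (16 : ℝ≥0∞) = 8 * 2 by norm_num, one_add_one_eq_two,
      ENNReal.mul_inv (by simp) (by simp), mul_assoc, ENNReal.inv_mul_cancel (by simp) (by simp),
      mul_one]
  rw [e16] at main
  rw [e24, mul_assoc]
  generalize ((M₀.historyLaw A T).expect fun h => (h.map (spikeGain p i₀ j b)).sum) = G at *
  have hfin : (8 : ℝ≥0∞) + 8 * G ≠ ⊤ :=
    ENNReal.add_ne_top.2 ⟨by simp, ENNReal.mul_ne_top (by simp) gain⟩
  refine (ENNReal.add_le_add_iff_right hfin).1 ?_
  rw [← add_assoc]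
  refine main.trans ((add_le_add_right (mul_le_mul_right loss 8) _).trans (le_of_eq ?_))
  ring

end Spike

/-! ### The parameter `λ` for deterministic transitions -/

theorem le_sq_mul_of_rpow_le {m F s : ℝ≥0∞} (hF : F ≠ 0) (hFt : F ≠ ⊤)
    (h : m ^ (1 / 2 : ℝ) * F ^ (-(1 / 2) : ℝ) ≤ s) : m ≤ s ^ 2 * F := by
  rw [ENNReal.rpow_neg, ← div_eq_mul_inv, ENNReal.div_le_iff] at h
  · have h2 := pow_le_pow_left₀ zero_le h 2
    rw [mul_pow, ← ENNReal.rpow_natCast, ← ENNReal.rpow_natCast (F ^ (1 / 2 : ℝ)),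
      ← ENNReal.rpow_mul, ← ENNReal.rpow_mul] at h2
    norm_num at h2
    exact_mod_cast h2
  · simp [hF]
  · exact ENNReal.rpow_ne_top_of_nonneg (by norm_num) hFt

namespace CausalMDP

variable {n k : ℕ} (M : CausalMDP n k)

section Deterministic

variable {tgt : Intervention n → Fin k}

theorem sum_P_mul_eq (hP : ∀ a i, M.P a i = PMF.pure (tgt a) i) (f : PMF (Intervention n))
    (i : Fin k) : ∑ b, M.P b i * f b = f.map tgt i := by
  rw [PMF.map, PMF.bind_apply, tsum_fintype]
  exact Finset.sum_congr rfl fun b _ => by rw [hP, mul_comm, Function.comp_apply]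

theorem lamObjective_eq (hP : ∀ a i, M.P a i = PMF.pure (tgt a) i)
    (f : PMF (Intervention n)) :
    M.lamObjective f = (⨆ a, (M.m (tgt a) : ℝ≥0∞) ^ (1 / 2 : ℝ) *
      (f.map tgt (tgt a)) ^ (-(1 / 2) : ℝ)) ^ 2 := by
  unfold lamObjective
  congr 1
  refine iSup_congr fun a => ?_
  simp only [M.sum_P_mul_eq hP]
  rw [Finset.sum_eq_single (tgt a)]
  · simp [hP]
  · intro i _ hi
    simp [hP, PMF.pure_apply, hi]
  · simp

theorem sum_m_le_lamObjective (hP : ∀ a i, M.P a i = PMF.pure (tgt a) i)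
    (hsurj : Function.Surjective tgt) (hm : ∀ i, 1 ≤ M.m i) (f : PMF (Intervention n)) :
    ((∑ i, M.m i : ℕ) : ℝ≥0∞) ≤ M.lamObjective f := by
  rw [M.lamObjective_eq hP]
  set s := ⨆ a, (M.m (tgt a) : ℝ≥0∞) ^ (1 / 2 : ℝ) * (f.map tgt (tgt a)) ^ (-(1 / 2) : ℝ) with hs
  have hle : ∀ i, (M.m i : ℝ≥0∞) ^ (1 / 2 : ℝ) * (f.map tgt i) ^ (-(1 / 2) : ℝ) ≤ s := by
    intro i
    obtain ⟨a, rfl⟩ := hsurj i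
    exact le_iSup (fun a => (M.m (tgt a) : ℝ≥0∞) ^ (1 / 2 : ℝ) *
      (f.map tgt (tgt a)) ^ (-(1 / 2) : ℝ)) a
  have hmul : ∀ i, (M.m i : ℝ≥0∞) ≤ s ^ 2 * f.map tgt i ∨ s = ⊤ := by
    intro i
    have hm0 : (M.m i : ℝ≥0∞) ≠ 0 := Nat.cast_ne_zero.2 (Nat.one_le_iff_ne_zero.1 (hm i))
    -- A state never visited under `f` makes the objective infinite: `0 ^ (-1/2) = ∞` is multiplied
    -- by a nonzero factor since `m_i ≥ 1`.
    by_cases hF : f.map tgt i = 0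
    · right
      have h := hle i
      rw [hF, ENNReal.zero_rpow_of_neg (by norm_num), ENNReal.mul_top] at h
      · exact top_le_iff.1 h
      · simp [hm0]
    · left
      exact le_sq_mul_of_rpow_le hF (PMF.apply_ne_top _ _) (hle i)
  by_cases hst : s = ⊤
  · simp [hst]
  · push_cast
    calc ∑ i, (M.m i : ℝ≥0∞) ≤ ∑ i, s ^ 2 * f.map tgt i :=
          Finset.sum_le_sum fun i _ => (hmul i).resolve_right hst
      _ = s ^ 2 := by
          rw [← Finset.mul_sum, ← tsum_fintype (L := .unconditional _), PMF.tsum_coe, mul_one]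

theorem exists_lamObjective_eq (hP : ∀ a i, M.P a i = PMF.pure (tgt a) i)
    (hsurj : Function.Surjective tgt) (hm : ∀ i, 1 ≤ M.m i) (i₁ : Fin k) :
    ∃ f, M.lamObjective f = ((∑ i, M.m i : ℕ) : ℝ≥0∞) := by
  set L : ℝ≥0∞ := ((∑ i, M.m i : ℕ) : ℝ≥0∞) with hL
  have hm0 : ∀ i, (M.m i : ℝ≥0∞) ≠ 0 := fun i =>
    Nat.cast_ne_zero.2 (Nat.one_le_iff_ne_zero.1 (hm i))
  have hLsum : L = ∑ i, (M.m i : ℝ≥0∞) := by rw [hL]; push_cast; rfl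
  have hL0 : L ≠ 0 := by
    rw [hLsum]
    intro h
    exact hm0 i₁ (Finset.sum_eq_zero_iff.1 h i₁ (Finset.mem_univ _))
  have hLt : L ≠ ⊤ := ENNReal.natCast_ne_top _
  -- Visiting states in proportion to `m_i` makes all the terms `m_i / F_i` equal to `L`.
  set g : PMF (Fin k) := PMF.ofFintype (fun i => (M.m i : ℝ≥0∞) / L) (by
    simp only [div_eq_mul_inv]
    rw [← Finset.sum_mul, ← hLsum, ENNReal.mul_inv_cancel hL0 hLt]) with hg
  obtain ⟨rep, hrep⟩ := hsurj.hasRightInverse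
  refine ⟨g.map rep, ?_⟩
  have hmap : (g.map rep).map tgt = g := by
    rw [PMF.map_comp, show tgt ∘ rep = id from funext hrep, PMF.map_id]
  have hterm : ∀ i, (M.m i : ℝ≥0∞) ^ (1 / 2 : ℝ) * (g i) ^ (-(1 / 2) : ℝ) = L ^ (1 / 2 : ℝ) := by
    intro i
    have hmt : (M.m i : ℝ≥0∞) ≠ ⊤ := ENNReal.natCast_ne_top _
    rw [show g i = (M.m i : ℝ≥0∞) / L from rfl, ENNReal.rpow_neg, ← ENNReal.inv_rpow,
      ENNReal.inv_div (.inl hLt) (.inl hL0), ← ENNReal.mul_rpow_of_nonneg _ _ (by norm_num),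
      ENNReal.mul_div_cancel (hm0 i) hmt]
  rw [M.lamObjective_eq hP, hmap]
  simp only [hterm]
  have : Nonempty (Intervention n) := ⟨none⟩
  rw [ciSup_const, ← ENNReal.rpow_natCast, ← ENNReal.rpow_mul]
  norm_num

theorem isLeast_lamObjective (hP : ∀ a i, M.P a i = PMF.pure (tgt a) i)
    (hsurj : Function.Surjective tgt) (hm : ∀ i, 1 ≤ M.m i) (i₁ : Fin k) :
    IsLeast (Set.range M.lamObjective) ((∑ i, M.m i : ℕ) : ℝ≥0∞) :=
  ⟨M.exists_lamObjective_eq hP hsurj hm i₁, by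
    rintro _ ⟨f, rfl⟩
    exact M.sum_m_le_lamObjective hP hsurj hm f⟩

theorem lam_eq_sum (hP : ∀ a i, M.P a i = PMF.pure (tgt a) i)
    (hsurj : Function.Surjective tgt) (hm : ∀ i, 1 ≤ M.m i) (i₁ : Fin k) :
    M.lam = ((∑ i, M.m i : ℕ) : ℝ≥0∞) :=
  (M.isLeast_lamObjective hP hsurj hm i₁).isGLB.sInf_eq

theorem one_le_pPlus (hP : ∀ a i, M.P a i = PMF.pure (tgt a) i) : 1 ≤ M.pPlus := by
  refine le_sInf ?_
  rintro p ⟨hp, a, i, rfl⟩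
  rw [hP, PMF.pure_apply] at hp ⊢
  split_ifs at hp ⊢
  · exact le_rfl
  · exact absurd rfl hp

theorem value_eq (hP : ∀ a i, M.P a i = PMF.pure (tgt a) i) (π : Policy n k) :
    M.value π = M.expReward (tgt π.1) (π.2 (tgt π.1)) := by
  unfold value
  rw [Finset.sum_eq_single (tgt π.1)]
  · simp [hP]
  · intro i _ hi
    simp [hP, PMF.pure_apply, hi]
  · simp

end Deterministic

/-! ### From missing the spike to regret -/

theorem subopt_ge (π π' : Policy n k) : M.value π' - M.value π ≤ M.subopt π :=
  sub_le_sub_right (le_ciSup (Set.finite_range M.value).bddAbove π') _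

theorem subopt_nonneg (π : Policy n k) : 0 ≤ M.subopt π := by
  simpa using M.subopt_ge π π

theorem regret_ge (A : Algorithm n k) (T : ℕ) {δ : ℝ} (hδ : 0 ≤ δ) (good : Policy n k → Prop)
    [DecidablePred good] (hbad : ∀ π, ¬ good π → δ ≤ M.subopt π)
    (hgood : (M.outputLaw A T).expect (fun π => if good π then 1 else 0) ≤ 3 / 4) :
    δ / 4 ≤ M.regret A T := by
  have hsum : ∑ π, (M.outputLaw A T π).toReal = 1 := by
    rw [← ENNReal.toReal_sum fun π _ => PMF.apply_ne_top _ _,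
      ← tsum_fintype (L := .unconditional _), PMF.tsum_coe, ENNReal.toReal_one]
  have hg : ∑ π, (M.outputLaw A T π).toReal * (if good π then 1 else 0) ≤ 3 / 4 := by
    have h := ENNReal.toReal_mono (by finiteness) hgood
    rw [PMF.expect_eq_sum, ENNReal.toReal_sum] at h
    · refine le_trans (le_of_eq (Finset.sum_congr rfl fun π _ => ?_)) (h.trans ?_)
      · split_ifs <;> simp
      · norm_num [ENNReal.toReal_div]
    · intro π _
      refine ENNReal.mul_ne_top (PMF.apply_ne_top _ _) ?_
      split_ifs <;> simp
  have hle : ∀ π ∈ Finset.univ, δ * ((M.outputLaw A T π).toReal -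
      (M.outputLaw A T π).toReal * (if good π then 1 else 0)) ≤
      (M.outputLaw A T π).toReal * M.subopt π := by
    intro π _
    split_ifs with h
    · simpa using mul_nonneg ENNReal.toReal_nonneg (M.subopt_nonneg π)
    · rw [mul_zero, sub_zero, mul_comm]
      exact mul_le_mul_of_nonneg_left (hbad π h) ENNReal.toReal_nonneg
  have := Finset.sum_le_sum hle
  rw [← Finset.mul_sum, Finset.sum_sub_distrib, hsum] at this
  refine le_trans ?_ this
  nlinarith

end CausalMDP

section Spike

variable {n k : ℕ}

theorem expReward_spiked (q0 : Fin n → unitInterval) (trans : Realization n → PMF (Fin k))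
    (q : Fin k → Fin n → unitInterval) (p : unitInterval) (i₀ : Fin k) (j : Fin n) (b : Bool)
    (i : Fin k) (a : Intervention n) :
    (⟨q0, trans, q, spikedRewards p i₀ j b⟩ : CausalMDP n k).expReward i a =
      1 / 2 + ((p : ℝ) - 1 / 2) * if i = i₀ then (coordLaw (q i) a j b).toReal else 0 := by
  have hsum : ∑ x, (varLaw (q i) a x).toReal = 1 := by
    rw [← ENNReal.toReal_sum fun π _ => PMF.apply_ne_top _ _,
      ← tsum_fintype (L := .unconditional _), PMF.tsum_coe, ENNReal.toReal_one]
  have hmarg : ∑ x, (varLaw (q i) a x).toReal * (if x j = b then 1 else 0) =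
      (coordLaw (q i) a j b).toReal := by
    rw [← varLaw_marginal, PMF.expect_eq_sum, ENNReal.toReal_sum]
    · refine Finset.sum_congr rfl fun x _ => ?_
      split_ifs <;> simp
    · intro x _
      refine ENNReal.mul_ne_top (PMF.apply_ne_top _ _) ?_
      split_ifs <;> simp
  have e : ∀ x, ((spikedRewards p i₀ j b i x : unitInterval) : ℝ) =
      1 / 2 + ((p : ℝ) - 1 / 2) * ((if i = i₀ then 1 else 0) * if x j = b then 1 else 0) := by
    intro x
    unfold spikedRewards
    by_cases h1 : i = i₀ <;> by_cases h2 : x j = b <;> simp [h1, h2, coe_unitHalf]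
  unfold CausalMDP.expReward
  simp only [e]
  calc ∑ x, (varLaw (q i) a x).toReal *
        (1 / 2 + ((p : ℝ) - 1 / 2) * ((if i = i₀ then 1 else 0) * if x j = b then 1 else 0))
      = 1 / 2 * ∑ x, (varLaw (q i) a x).toReal + ((p : ℝ) - 1 / 2) * ((if i = i₀ then 1 else 0) *
          ∑ x, (varLaw (q i) a x).toReal * if x j = b then 1 else 0) := by
        rw [Finset.mul_sum, Finset.mul_sum, Finset.mul_sum, ← Finset.sum_add_distrib]
        exact Finset.sum_congr rfl fun x _ => by ring
    _ = _ := by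
        rw [hsum, hmarg, mul_one, ite_mul, one_mul, zero_mul]

/-- The comparison policy reaches `i₀` and forces the rare value, so it always collects the bias.
Any other policy meets the spike with probability at most `1 / 2`, because the value is the rarer
one. -/
theorem subopt_spiked_ge (q0 : Fin n → unitInterval) (trans : Realization n → PMF (Fin k))
    (q : Fin k → Fin n → unitInterval) {p : unitInterval} (hp : 1 / 2 ≤ (p : ℝ))
    (i₀ : Fin k) (j : Fin n) {tgt : Intervention n → Fin k}
    (hP : ∀ a i, (⟨q0, trans, q, spikedRewards p i₀ j (rareValue (q i₀) j)⟩ :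
      CausalMDP n k).P a i = PMF.pure (tgt a) i)
    (hsurj : Function.Surjective tgt) (π : Policy n k)
    (hπ : ¬ (tgt π.1 = i₀ ∧ π.2 i₀ = some (j, rareValue (q i₀) j))) :
    ((p : ℝ) - 1 / 2) / 2 ≤ (⟨q0, trans, q, spikedRewards p i₀ j (rareValue (q i₀) j)⟩ :
      CausalMDP n k).subopt π := by
  obtain ⟨a₀, ha₀⟩ := hsurj i₀
  refine le_trans ?_ (CausalMDP.subopt_ge _ π (a₀, fun _ => some (j, rareValue (q i₀) j)))
  rw [CausalMDP.value_eq _ hP, CausalMDP.value_eq _ hP, expReward_spiked, expReward_spiked]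
  simp only [ha₀, if_true, coordLaw_self, ENNReal.toReal_one]
  have hle : (if tgt π.1 = i₀ then (coordLaw (q (tgt π.1)) (π.2 (tgt π.1)) j
      (rareValue (q i₀) j)).toReal else 0) ≤ 1 / 2 := by
    split_ifs with h
    · have hne : π.2 i₀ ≠ some (j, rareValue (q i₀) j) := fun e => hπ ⟨h, e⟩
      rw [h]
      have hc := coordLaw_of_ne (q i₀) hne
      rw [coin_rareValue] at hc
      exact ENNReal.toReal_le_of_le_ofReal (by norm_num)
        (hc.trans (ENNReal.ofReal_le_ofReal (lesserProb_le_half _ _)))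
    · norm_num
  nlinarith

theorem list_sum_map_finset_sum {α ι N : Type*} [AddCommMonoid N] (s : Finset ι)
    (φ : ι → α → N) (l : List α) :
    (l.map fun a => ∑ i ∈ s, φ i a).sum = ∑ i ∈ s, (l.map (φ i)).sum := by
  induction l with
  | nil => simp
  | cons a l ih => simp only [List.map_cons, List.sum_cons, ih, Finset.sum_add_distrib]

/-- On average over the spikes, the spike is identified with bounded probability. -/
theorem sum_expect_good_le (q0 : Fin n → unitInterval) (trans : Realization n → PMF (Fin k))
    (q : Fin k → Fin n → unitInterval) {p : unitInterval} (h0 : 1 / 2 ≤ (p : ℝ))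
    (h1 : (p : ℝ) ≤ 3 / 4) (tgt : Intervention n → Fin k) (J : Fin k → Finset (Fin n))
    (hJ : ∀ i, ∀ j ∈ J i, lesserProb (q i) j ≤ 1 / ((J i).card : ℝ))
    (A : Algorithm n k) (T : ℕ) :
    ∑ σ ∈ Finset.univ.sigma J,
      ((⟨q0, trans, q, spikedRewards p σ.1 σ.2 (rareValue (q σ.1) σ.2)⟩ :
        CausalMDP n k).outputLaw A T).expect (fun π =>
          if tgt π.1 = σ.1 ∧ π.2 σ.1 = some (σ.2, rareValue (q σ.1) σ.2) then 1 else 0) ≤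
      1 + (∑ i, (J i).card : ℕ) * 8⁻¹ +
        ENNReal.ofReal (24 * ((p : ℝ) - 1 / 2) ^ 2) * (T * 2) := by
  set M₀ : CausalMDP n k := ⟨q0, trans, q, fun _ _ => unitHalf⟩ with hM₀
  have hone : ∀ σ ∈ Finset.univ.sigma J, _ := fun σ _ =>
    expect_historyLaw_spiked_le q0 trans q h0 h1 σ.1 σ.2 (rareValue (q σ.1) σ.2) A T
      (g := fun h => (A.output h).expect fun π =>
        if tgt π.1 = σ.1 ∧ π.2 σ.1 = some (σ.2, rareValue (q σ.1) σ.2) then 1 else 0)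
      fun h => PMF.expect_le_const _ fun π => by split_ifs <;> simp
  simp only [CausalMDP.expect_outputLaw]
  refine (Finset.sum_le_sum hone).trans ?_
  rw [Finset.sum_add_distrib, Finset.sum_add_distrib, Finset.sum_const, Finset.card_sigma,
    nsmul_eq_mul, ← Finset.mul_sum, ← PMF.expect_finset_sum, ← PMF.expect_finset_sum]
  refine add_le_add (add_le_add ?_ le_rfl) (mul_le_mul_right ?_ _)
  -- A policy is good for at most one spike: its target fixes the state, and its intervention there
  -- fixes the variable.
  · refine PMF.expect_le_const _ fun h => ?_
    rw [← PMF.expect_finset_sum]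
    refine PMF.expect_le_const _ fun π => ?_
    rw [Finset.sum_ite, Finset.sum_const_zero, add_zero, Finset.sum_const, nsmul_eq_mul, mul_one]
    refine Nat.cast_le_one.2 (Finset.card_le_one.2 ?_)
    rintro ⟨i, j⟩ hσ ⟨i', j'⟩ hσ'
    obtain ⟨-, e1, e2⟩ := Finset.mem_filter.1 hσ
    obtain ⟨-, e1', e2'⟩ := Finset.mem_filter.1 hσ'
    dsimp only at e1 e2 e1' e2'
    obtain rfl : i = i' := e1.symm.trans e1'
    have := congrArg (Option.map Prod.fst) (e2.symm.trans e2')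
    simp only [Option.map_some, Option.some.injEq] at this
    rw [this]
  -- A round can only hit spikes at the state it visits, on average at most two of them.
  · refine le_trans (le_of_eq (congrArg _ (funext fun h => (list_sum_map_finset_sum _
      (fun (σ : (_ : Fin k) × Fin n) ρ =>
        if ρ.Hits σ.1 σ.2 (rareValue (q σ.1) σ.2) then (1 : ℝ≥0∞) else 0) h).symm))) ?_
    refine M₀.expect_historyLaw_sum_le A T fun h => ?_
    rw [CausalMDP.expect_roundLaw]
    refine PMF.expect_le_const _ fun a => PMF.expect_le_const _ fun x0 =>
      PMF.expect_le_const _ fun i => PMF.expect_le_const _ fun c => ?_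
    refine le_trans (PMF.expect_mono _ (g := fun x => ∑ σ ∈ Finset.univ.sigma J,
      if i = σ.1 ∧ x σ.2 = rareValue (q σ.1) σ.2 then 1 else 0)
      fun x => PMF.expect_le_const _ fun r => le_rfl) ?_
    rw [PMF.expect_finset_sum, Finset.sum_sigma, Finset.sum_eq_single i]
    · refine le_trans (le_of_eq (Finset.sum_congr rfl fun j _ => ?_))
        (sum_coordLaw_rareValue_le (q i) (J i) (hJ i) c)
      rw [← varLaw_marginal]
      simp [hM₀]
    · intro i' _ hi'
      refine Finset.sum_eq_zero fun j _ => ?_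
      simp [hi'.symm, PMF.expect_const]
    · simp

/-- The success probability of the spike. -/
noncomputable def spikeProb (L T : ℕ) : unitInterval :=
  ⟨1 / 2 + 1 / 20 * min 1 (Real.sqrt ((L : ℝ) / T)), by positivity, by
    have := min_le_left 1 (Real.sqrt ((L : ℝ) / T))
    linarith⟩

theorem exists_spike_regret_ge (q0 : Fin n → unitInterval) (trans : Realization n → PMF (Fin k))
    {tgt : Intervention n → Fin k}
    (hP : ∀ q r a i, (⟨q0, trans, q, r⟩ : CausalMDP n k).P a i = PMF.pure (tgt a) i)
    (hsurj : Function.Surjective tgt) (hk : 2 ≤ k) (hn : 0 < n)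
    (q : Fin k → Fin n → unitInterval) (A : Algorithm n k) {T : ℕ} (hT : 1 ≤ T) {L : ℕ}
    (hL : L = ∑ i, causalParam (q i)) :
    ∃ i j b, 1 / 160 * min 1 (Real.sqrt ((L : ℝ) / T)) ≤
      (⟨q0, trans, q, spikedRewards (spikeProb L T) i j b⟩ : CausalMDP n k).regret A T := by
  choose J hJcard hJ using fun i => exists_rare_finset hn (q i)
  set p := spikeProb L T with hp
  have hT0 : (0 : ℝ) < T := by exact_mod_cast hT
  have hμ0 : 0 ≤ min 1 (Real.sqrt ((L : ℝ) / T)) := by positivity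
  have hμ1 := min_le_left 1 (Real.sqrt ((L : ℝ) / T))
  have hμT : (min 1 (Real.sqrt ((L : ℝ) / T))) ^ 2 * T ≤ L := by
    have h := pow_le_pow_left₀ hμ0 (min_le_right 1 (Real.sqrt ((L : ℝ) / T))) 2
    rw [Real.sq_sqrt (by positivity), le_div_iff₀ hT0] at h
    exact h
  have hpe : (p : ℝ) = 1 / 2 + 1 / 20 * min 1 (Real.sqrt ((L : ℝ) / T)) := rfl
  generalize min 1 (Real.sqrt ((L : ℝ) / T)) = μ at *
  have hL2 : 2 ≤ L := by
    rw [hL]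
    calc 2 ≤ ∑ _i : Fin k, 1 := by simpa using hk
      _ ≤ _ := Finset.sum_le_sum fun i _ => one_le_causalParam hn (q i)
  have hcard : ∑ i, (J i).card = L := by rw [hL]; exact Finset.sum_congr rfl fun i _ => hJcard i
  have hsum := sum_expect_good_le q0 trans q (p := p) (by linarith) (by linarith) tgt J
    (fun i j hj => by rw [hJcard]; exact hJ i j hj) A T
  -- The bias is `μ / 20` and `μ² T ≤ L`, so the last term is at most `48 L / 400`. Together with `L
  -- / 8` and `1 ≤ L / 2` the total stays below `3 L / 4`.
  have hbound : (1 : ℝ≥0∞) + (∑ i, (J i).card : ℕ) * 8⁻¹ +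
        ENNReal.ofReal (24 * ((p : ℝ) - 1 / 2) ^ 2) * (T * 2) ≤
      ∑ _σ ∈ Finset.univ.sigma J, (3 / 4 : ℝ≥0∞) := by
    rw [Finset.sum_const, Finset.card_sigma, nsmul_eq_mul, hcard, hpe]
    rw [← ENNReal.toReal_le_toReal (by finiteness) (by finiteness),
      ENNReal.toReal_add (by finiteness) (by finiteness),
      ENNReal.toReal_add (by finiteness) (by finiteness)]
    simp only [ENNReal.toReal_mul, ENNReal.toReal_one, ENNReal.toReal_natCast,
      ENNReal.toReal_inv, ENNReal.toReal_ofNat, ENNReal.toReal_div]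
    rw [ENNReal.toReal_ofReal (by positivity)]
    have : (2 : ℝ) ≤ L := by exact_mod_cast hL2
    nlinarith
  have hne : (Finset.univ.sigma J).Nonempty := by
    rw [← Finset.card_pos, Finset.card_sigma, hcard]
    lia
  obtain ⟨σ, hσ⟩ : ∃ σ : (_ : Fin k) × Fin n, ((⟨q0, trans, q,
      spikedRewards p σ.1 σ.2 (rareValue (q σ.1) σ.2)⟩ : CausalMDP n k).outputLaw A T).expect
        (fun π => if tgt π.1 = σ.1 ∧ π.2 σ.1 = some (σ.2, rareValue (q σ.1) σ.2) then 1 else 0) ≤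
      3 / 4 := by
    by_contra! hlt
    exact (hsum.trans hbound).not_gt
      (ENNReal.sum_lt_sum_of_nonempty hne fun σ _ => hlt σ)
  refine ⟨σ.1, σ.2, rareValue (q σ.1) σ.2, ?_⟩
  -- The constant is `1 / 160 = 1 / 20 · 1 / 2 · 1 / 4`: size of the bias, fraction of it lost,
  -- probability of a miss.
  have := CausalMDP.regret_ge _ A T (δ := ((p : ℝ) - 1 / 2) / 2) (by rw [hpe]; linarith) _
    (fun π hπ => subopt_spiked_ge q0 trans q (p := p) (by linarith) σ.1 σ.2 (hP _ _) hsurj π hπ)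
    hσ
  refine le_trans (le_of_eq ?_) this
  rw [hpe]
  ring

end Spike

/-! ### The deterministic start state -/

section Gate

variable {n : ℕ}

/-- The values of the variables under an intervention when all of them are `0` by default. -/
def forcedValues (a : Intervention n) : Realization n :=
  fun j => decide (a = some (j, true))

theorem varLaw_zero (a : Intervention n) :
    varLaw (fun _ => 0) a = PMF.pure (forcedValues a) := by
  have hcoord : ∀ j, coordLaw (fun _ => 0) a j = PMF.pure (forcedValues a j) := by
    intro j
    match a with
    | none => simp [coordLaw, coin_zero, forcedValues]
    | some (j', b) =>
      by_cases h : j' = j <;> cases b <;> simp [coordLaw, coin_zero, forcedValues, h]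
  ext x
  rw [varLaw_apply, PMF.pure_apply]
  simp only [hcoord, PMF.pure_apply]
  split_ifs with h
  · simp [h]
  · obtain ⟨j, hj⟩ := Function.ne_iff.1 h
    exact Finset.prod_eq_zero (Finset.mem_univ j) (if_neg hj)

open Classical in
/-- The state with the number of some variable that equals `1`, or the last state if there is
none. -/
noncomputable def gate (x : Realization n) : Fin (n + 1) :=
  if h : ∃ j, x j = true then h.choose.castSucc else Fin.last n

/-- An intervention sets at most one variable to `1`, so the choice made in `gate` is forced. -/
theorem gate_surjective :
    Function.Surjective fun a : Intervention n => gate (forcedValues a) := by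
  intro i
  refine Fin.lastCases ⟨none, ?_⟩ (fun j => ⟨some (j, true), ?_⟩) i
  · simp [gate, forcedValues]
  · have h : ∃ i, forcedValues (some (j, true)) i = true := ⟨j, by simp [forcedValues]⟩
    have hj : ∀ i, forcedValues (some (j, true)) i = true → j = i := fun i hi => by
      simpa [forcedValues] using hi
    simp only [gate, dif_pos h]
    exact congrArg Fin.castSucc (hj _ h.choose_spec).symm

theorem P_gate (q : Fin (n + 1) → Fin n → unitInterval) (r : Rewards n (n + 1))
    (a : Intervention n) (i : Fin (n + 1)) :
    (⟨fun _ => 0, fun x => PMF.pure (gate x), q, r⟩ : CausalMDP n (n + 1)).P a i =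
      PMF.pure (gate (forcedValues a)) i := by
  rw [CausalMDP.P, varLaw_zero, PMF.pure_bind]

end Gate

theorem theorem2 :
    ∃ c : ℝ, 0 < c ∧ ∀ k n : ℕ, 2 ≤ k → n + 1 = k →
      ∃ (q0 : Fin n → unitInterval) (trans : Realization n → PMF (Fin k)),
        (∀ (q : Fin k → Fin n → unitInterval) (r : Rewards n k),
          let M : CausalMDP n k := ⟨q0, trans, q, r⟩
          (∀ a i, M.P a i = 0 ∨ M.P a i = 1) ∧
          IsLeast (Set.range M.lamObjective) M.lam ∧
          M.lam = ((∑ i, M.m i : ℕ) : ℝ≥0∞) ∧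
          (M.m0 : ℝ≥0∞) / M.pPlus ≤ M.lam) ∧
        ∀ T : ℕ, 1 ≤ T → ∃ 𝓡 : Set (Rewards n k), 𝓡.Finite ∧
          ∀ (q : Fin k → Fin n → unitInterval) (A : Algorithm n k), ∃ r ∈ 𝓡,
            let M : CausalMDP n k := ⟨q0, trans, q, r⟩
            c * min 1 (Real.sqrt (M.lam.toReal / (T : ℝ))) ≤ M.regret A T := by
  refine ⟨1 / 160, by norm_num, ?_⟩
  rintro k n hk rfl
  have hn : 0 < n := by lia
  have hm : ∀ (q : Fin (n + 1) → Fin n → unitInterval) (r : Rewards n (n + 1)) i,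
      1 ≤ (⟨fun _ => 0, fun x => PMF.pure (gate x), q, r⟩ : CausalMDP n (n + 1)).m i :=
    fun q _ i => one_le_causalParam hn (q i)
  have hlam := fun q r => CausalMDP.lam_eq_sum _ (P_gate q r) gate_surjective (hm q r) 0
  refine ⟨fun _ => 0, fun x => PMF.pure (gate x), fun q r => ⟨fun a i => ?_, ?_, hlam q r, ?_⟩,
    fun T hT => ?_⟩
  · rw [P_gate, PMF.pure_apply]
    split_ifs <;> simp
  · rw [hlam q r]
    exact CausalMDP.isLeast_lamObjective _ (P_gate q r) gate_surjective (hm q r) 0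
  · rw [hlam q r]
    -- Here `p_+ ≥ 1`, while `m_0 ≤ n` and each of the `n + 1` states contributes at least one to `∑
    -- m_i`.
    refine (ENNReal.div_le_div_left (CausalMDP.one_le_pPlus _ (P_gate q r)) _).trans ?_
    rw [div_one]
    refine Nat.cast_le.2 ((causalParam_le _).trans ?_)
    calc n ≤ ∑ _i : Fin (n + 1), 1 := by simp
      _ ≤ _ := Finset.sum_le_sum fun i _ => hm q r i
  -- The bias depends on `q` only through `∑ m_i ≤ (n + 1) n`; including all possible values of this
  -- sum keeps the family finite and independent of `q`.
  · refine ⟨Set.range fun s : Fin ((n + 1) * n + 1) × Fin (n + 1) × Fin n × Bool =>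
      spikedRewards (spikeProb s.1 T) s.2.1 s.2.2.1 s.2.2.2, Set.finite_range _, fun q A => ?_⟩
    have hLle : ∑ i, causalParam (q i) < (n + 1) * n + 1 := by
      refine Nat.lt_succ_of_le ((Finset.sum_le_sum fun i _ => causalParam_le (q i)).trans ?_)
      simp
    obtain ⟨i, j, b, h⟩ := exists_spike_regret_ge (fun _ => 0) (fun x => PMF.pure (gate x))
      P_gate gate_surjective hk hn q A hT rfl
    refine ⟨_, ⟨(⟨_, hLle⟩, i, j, b), rfl⟩, ?_⟩
    dsimp only
    rw [hlam, ENNReal.toReal_natCast]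
    exact h
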